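/- Let $(X,\rho)$ be a non-empty compact metric space and $D$ a finite set of maps $d\colon X^{\mathrm{ar}(d)}\to X$ of positive finite arity, each contracting with respect to the maximum metric on $X^{\mathrm{ar}(d)}$, with $X=\bigcup_{d\in D}\mathrm{range}(d)$ (a digit space). Let $Q$ be a countable dense set of coded "basic elements" of $X$; all procedures below work on codes of basic elements, rationals and digits. Assume that $(X,D,Q)$ is a computable digit space: the sets $\{(u,v,r)\in Q^2\times\mathbb{Q} : \rho(u,v)<r\}$ and $\{(u,v,r)\in Q^2\times\mathbb{Q} : \rho(u,v)>r\}$ are effectively enumerable, and every $d\in D$ is computable, i.e. has a computable modulus of uniform continuity $\zeta\colon\mathbb{Q}_+\to\mathbb{Q}_+$, and from $\vec u\in Q^{\mathrm{ar}(d)}$ and $n\in\mathbb{N}$ one can compute $v\in Q$ with $\rho(d(\vec u),v)<2^{-n}$. Assume moreover that $(X,D,Q)$ is - well-covering: every $x\in X$ lies in $\mathrm{int}(\mathrm{range}(d))$ for some $d\in D$; - decidable: for $u\in Q$, $\theta\in\mathbb{Q}_+$, $d\in D$ it can be decided whether the open ball $B_\rho(u,\theta)$ is contained in $\mathrm{range}(d)$;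 - with approximable choice: for every $d\in D$ there is an effective procedure $(\theta,u)\mapsto v^\theta_u\in Q^{\mathrm{ar}(d)}$, defined for $\theta\in\mathbb{Q}_+$ and $u\in\mathrm{int}(\mathrm{range}(d))\cap Q$, such that (1) $\rho(v^\theta_u,v^{\tilde\theta}_u)<\max\{\theta,\tilde\theta\}$ for all $u,\theta,\tilde\theta$; (2) from $\theta$ one can compute $\theta'\in\mathbb{Q}_+$ such that, for all $u,u'$, $\rho(u,u')<\theta'$ implies $\rho(v^\theta_u,v^\theta_{u'})<\theta$; (3) for all $\theta,u$ there is $\vec y\in X^{\mathrm{ar}(d)}$ with $d(\vec y)=u$ and $\rho(\vec y,v^\theta_u)<\theta$. Let $\mathcal{T}^\omega_D$ be the set of infinite $D$-trees, that is, trees whose nodes are labelled by elements of $D$ and in which a node labelled $d$ has exactly $\mathrm{ar}(d)$ ordered children. Let $T^{(n)}$ be the initial segment of $T$ of height $n$. A finite tree $S$ defines a map $f_S$, where $f_S=d$ if $S$ is a single node labelled $d$, and $f_S=d\circ(f_{S_1}\times\dots\times f_{S_{\mathrm{ar}(d)}})$ if $S$ has root label $d$ and immediate subtrees $S_1,\dots,S_{\mathrm{ar}(d)}$.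 Let $[\![T]\!]$ be the unique element of $\bigcap_n\mathrm{range}(f_{T^{(n)}})$. The Cauchy representation is the partial map $\rho_C$ from $Q^\omega$ to $X$ with $\rho_C(w)=x$ iff $\rho(x,w_n)<2^{-n}$ for all $n\in\mathbb{N}$. The tree representation maps the stream $(T^{(n)})_{n\in\mathbb{N}}$ to $[\![T]\!]$. A (partial) operator is called computable if it is computed, in the sense of Type-Two Theory of Effectivity, on its domain, where trees $T$ are given by the streams $(T^{(n)})_{n\in\mathbb{N}}$ and elements of $Q^\omega$ by the sequences of (codes of) their terms. Then there are a computable operator $F\colon\mathcal{T}^\omega_D\to Q^\omega$ and a computable partial operator $G$ from $Q^\omega$ to $\mathcal{T}^\omega_D$ with $\mathrm{dom}(G)=\mathrm{dom}(\rho_C)$ such that for all $T\in\mathcal{T}^\omega_D$ and $w\in\mathrm{dom}(G)$, \[ \rho_C(F(T))=[\![T]\!]\quad\text{and}\quad[\![G(w)]\!]=\rho_C(w). \] Hence the tree representation and the Cauchy representation of $X$ are computably equivalent, i.e. names of either kind can be computably translated into names of the other kind of the same point. -/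

import Mathlib

universe u v

/-- A pair `(a, b)` of natural numbers is a code of the positive rational number `(a + 1) / (b + 1)`;
every positive rational has such a code. -/
def posRat (c : ℕ × ℕ) : ℚ := ((c.1 : ℚ) + 1) / ((c.2 : ℚ) + 1)

/-- A triple `(a, b, c)` of natural numbers is a code of the rational number `(a - b) / (c + 1)`;
every rational has such a code. -/
def ratVal (c : ℕ × ℕ × ℕ) : ℚ := ((c.1 : ℚ) - (c.2.1 : ℚ)) / ((c.2.2 : ℚ) + 1)

/-! ### Trees labelled by digits

The digits are `Fin m`, and `ar d` is the outdegree (arity) of a node labelled `d`.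
The children of a node labelled `d` are numbered `0, …, ar d - 1`. -/

/-- Finite `D`-trees: a single node, or `[d; T_1, …, T_{ar d}]`. -/
inductive FinTree {m : ℕ} (ar : Fin m → ℕ) : Type
  | leaf (d : Fin m) : FinTree ar
  | node (d : Fin m) (ts : Fin (ar d) → FinTree ar) : FinTree ar

namespace FinTree

variable {m : ℕ} {ar : Fin m → ℕ}

/-- The argument places of the map `f_S` defined by a finite tree `S`; their number is `ar(S)`,
which is `ar(d)` for a single node `d` and `∑ ar(T_i)` for `[d; T_1, …, T_{ar d}]`. -/
def Slot : FinTree ar → Type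
  | leaf d => Fin (ar d)
  | node d ts => Σ i : Fin (ar d), (ts i).Slot

/-- A finite tree as a finite object: the list, in depth-first order, of all pairs of a node
(a word over `ℕ`) and its label. -/
def graph : FinTree ar → List (List ℕ × Fin m)
  | leaf d => [([], d)]
  | node d ts =>
      ([], d) :: (List.ofFn fun i : Fin (ar d) =>
        (ts i).graph.map fun p => ((i : ℕ) :: p.1, p.2)).flatten

end FinTree

/-- Infinite `D`-trees: a non-empty tree `S` of words together with a labelling `L : S → D`, such
that a node `s` has exactly the children `s ⋆ i` with `i < ar (L s)`. The pair `(S, L)` is given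
by the partial map `label`, whose domain is `S`. -/
@[ext] structure InfTree {m : ℕ} (ar : Fin m → ℕ) : Type where
  label : List ℕ → Option (Fin m)
  root_mem : (label []).isSome
  mem_snoc : ∀ (s : List ℕ) (i : ℕ),
    (label (s ++ [i])).isSome ↔ ∃ d, label s = some d ∧ i < ar d

namespace InfTree

variable {m : ℕ} {ar : Fin m → ℕ}

/-- The label of the root. -/
def root (T : InfTree ar) : Fin m := (T.label []).get T.root_mem

theorem label_nil (T : InfTree ar) : T.label [] = some T.root := by
  simp [root]

/-- The `i`-th immediate subtree. -/
def subtree (T : InfTree ar) (i : Fin (ar T.root)) : InfTree ar where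
  label s := T.label ((i : ℕ) :: s)
  root_mem := by
    have h := (T.mem_snoc [] (i : ℕ)).2 ⟨T.root, T.label_nil, i.2⟩
    simpa using h
  mem_snoc s j := by
    have h := T.mem_snoc ((i : ℕ) :: s) j
    simpa using h

/-- The initial segment `T^(n)` of height `n`. -/
def init : ℕ → (T : InfTree ar) → FinTree ar
  | 0, T => .leaf T.root
  | n + 1, T => .node T.root fun i => init n (T.subtree i)

/-- The stream `T^(0) : T^(1) : ⋯` of finite trees by which an infinite tree is given to, or
returned by, a computation. -/
def stream (T : InfTree ar) (n : ℕ) : List (List ℕ × Fin m) := (T.init n).graph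

end InfTree

/-! ### Digit spaces -/

/-- A finite family of maps `d : X^(ar d) → X` of positive finite arity. -/
structure DigitSystem (X : Type u) (m : ℕ) where
  ar : Fin m → ℕ
  ar_pos : ∀ d, 0 < ar d
  map : ∀ d, (Fin (ar d) → X) → X

namespace DigitSystem

variable {X : Type u} {m : ℕ}

/-- The map `f_S : X^(ar S) → X` defined by a finite tree `S`. -/
def treeMap (D : DigitSystem X m) : (S : FinTree D.ar) → (S.Slot → X) → X
  | .leaf d, x => D.map d x
  | .node d ts, x => D.map d fun i => treeMap D (ts i) fun s => x ⟨i, s⟩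

/-- A digit space: a non-empty compact metric space covered by the ranges of finitely many
contracting maps, where powers of `X` carry the maximum metric. -/
structure IsDigitSpace [MetricSpace X] (D : DigitSystem X m) : Prop where
  nonempty : Nonempty X
  compact : CompactSpace X
  covering : ∀ x : X, ∃ d, x ∈ Set.range (D.map d)
  contracting : ∀ d, ∃ q : NNReal, q < 1 ∧ LipschitzWith q (D.map d)

/-- Every point lies in the interior of the range of some digit. -/
def WellCovering [MetricSpace X] (D : DigitSystem X m) : Prop :=
  ∀ x : X, ∃ d, x ∈ interior (Set.range (D.map d))

section Value

variable {D : DigitSystem X m}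

theorem range_treeMap_node (d : Fin m) (ts : Fin (D.ar d) → FinTree D.ar) :
    Set.range (D.treeMap (.node d ts)) =
      D.map d '' Set.univ.pi fun i => Set.range (D.treeMap (ts i)) := by
  ext y
  constructor
  · rintro ⟨x, rfl⟩
    exact ⟨fun i => D.treeMap (ts i) fun s => x ⟨i, s⟩, fun i _ => ⟨_, rfl⟩, rfl⟩
  · rintro ⟨z, hz, rfl⟩
    choose x hx using fun i => hz i (Set.mem_univ i)
    exact ⟨fun p => x p.1 p.2, congrArg (D.map d) (funext hx)⟩

theorem range_treeMap_init_succ (n : ℕ) (T : InfTree D.ar) :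
    Set.range (D.treeMap (T.init (n + 1))) ⊆ Set.range (D.treeMap (T.init n)) := by
  induction n generalizing T with
  | zero =>
    simp only [InfTree.init]
    rw [range_treeMap_node]
    rintro _ ⟨z, _, rfl⟩
    exact ⟨z, rfl⟩
  | succ n ih =>
    rw [InfTree.init, InfTree.init, range_treeMap_node, range_treeMap_node]
    exact Set.image_mono (Set.pi_mono fun i _ => ih (T.subtree i))

variable [MetricSpace X]

theorem IsDigitSpace.exists_factor (h : D.IsDigitSpace) :
    ∃ q : NNReal, q < 1 ∧ ∀ d, LipschitzWith q (D.map d) := by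
  choose q hq hL using h.contracting
  refine ⟨Finset.univ.sup q, ?_, fun d => (hL d).weaken (Finset.le_sup (Finset.mem_univ d))⟩
  exact (Finset.sup_lt_iff (by simp)).2 fun d _ => hq d

theorem IsDigitSpace.isCompact_range_treeMap (h : D.IsDigitSpace) (S : FinTree D.ar) :
    IsCompact (Set.range (D.treeMap S)) := by
  have := h.compact
  induction S with
  | leaf d =>
    obtain ⟨q, _, hq⟩ := h.contracting d
    change IsCompact (Set.range (D.map d))
    exact isCompact_range hq.continuous
  | node d ts ih =>
    rw [range_treeMap_node]
    obtain ⟨q, _, hq⟩ := h.contracting d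
    exact (isCompact_univ_pi ih).image hq.continuous

theorem IsDigitSpace.range_treeMap_nonempty (h : D.IsDigitSpace) (S : FinTree D.ar) :
    (Set.range (D.treeMap S)).Nonempty := by
  obtain ⟨x⟩ := h.nonempty
  exact ⟨_, fun _ => x, rfl⟩

theorem dist_le_of_mem_range_init {q : NNReal} (hq : ∀ d, LipschitzWith q (D.map d)) {M : ℝ}
    (hM : ∀ x y : X, dist x y ≤ M) (n : ℕ) (T : InfTree D.ar) {x y : X}
    (hx : x ∈ Set.range (D.treeMap (T.init n))) (hy : y ∈ Set.range (D.treeMap (T.init n))) :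
    dist x y ≤ q ^ n * M := by
  induction n generalizing T x y with
  | zero => simpa using hM x y
  | succ n ih =>
    rw [InfTree.init, range_treeMap_node] at hx hy
    obtain ⟨a, ha, rfl⟩ := hx
    obtain ⟨b, hb, rfl⟩ := hy
    have hM0 : 0 ≤ M := dist_nonneg.trans (hM (D.map _ a) (D.map _ b))
    refine ((hq _).dist_le_mul a b).trans ?_
    rw [pow_succ', mul_assoc]
    refine mul_le_mul_of_nonneg_left ?_ q.2
    exact (dist_pi_le_iff (by positivity)).2 fun i =>
      ih (T.subtree i) (ha i (Set.mem_univ i)) (hb i (Set.mem_univ i))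

theorem IsDigitSpace.existsUnique_value (h : D.IsDigitSpace) (T : InfTree D.ar) :
    ∃! x : X, x ∈ ⋂ n, Set.range (D.treeMap (T.init n)) := by
  have := h.compact
  obtain ⟨x, hx⟩ := IsCompact.nonempty_iInter_of_sequence_nonempty_isCompact_isClosed
    (fun n => Set.range (D.treeMap (T.init n)))
    (fun n => range_treeMap_init_succ n T)
    (fun n => h.range_treeMap_nonempty _)
    (h.isCompact_range_treeMap _)
    (fun n => (h.isCompact_range_treeMap _).isClosed)
  refine ⟨x, hx, fun y hy => ?_⟩
  obtain ⟨q, hq1, hq⟩ := h.exists_factor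
  obtain ⟨M, hM⟩ := Metric.isBounded_iff.1 (isCompact_univ (X := X)).isBounded
  have hle : ∀ n : ℕ, dist y x ≤ (q : ℝ) ^ n * M := fun n =>
    dist_le_of_mem_range_init hq (fun a b => hM (Set.mem_univ a) (Set.mem_univ b)) n T
      (Set.mem_iInter.1 hy n) (Set.mem_iInter.1 hx n)
  have hlim : Filter.Tendsto (fun n : ℕ => (q : ℝ) ^ n * M) Filter.atTop (nhds 0) := by
    simpa using (tendsto_pow_atTop_nhds_zero_of_lt_one q.2 (by exact_mod_cast hq1)).mul_const M
  exact dist_le_zero.1 (ge_of_tendsto' hlim hle)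

/-- The coding map: `⟦T⟧` is the unique element of `⋂ n, range f_{T^(n)}`. -/
noncomputable def IsDigitSpace.val (h : D.IsDigitSpace) (T : InfTree D.ar) : X :=
  (h.existsUnique_value T).choose

end Value

/-! ### Computability

The countable dense set of basic elements is given by a type `Q` of finite objects (a
`Primcodable` type, on which computability is Mathlib's) and the map `ι : Q → X` with dense range
that sends a finite object to the basic element it denotes. It need not be injective, so `Q` may
be an honest countable subset with `ι` the inclusion, as well as `ℕ` with `ι` an enumeration of the
basic elements, with repetitions. -/

section Computability

variable [MetricSpace X] {Q : Type v} [Primcodable Q]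

/-- The metric space `X` is computable with respect to the basic elements. -/
structure _root_.IsComputableMetric (ι : Q → X) : Prop where
  dense : DenseRange ι
  lt_re : REPred fun p : Q × Q × (ℕ × ℕ × ℕ) => dist (ι p.1) (ι p.2.1) < (ratVal p.2.2 : ℝ)
  gt_re : REPred fun p : Q × Q × (ℕ × ℕ × ℕ) => (ratVal p.2.2 : ℝ) < dist (ι p.1) (ι p.2.1)

/-- A map `f : X^k → X` is computable: it has a computable modulus of (uniform) continuity, and
one can compute its values on basic elements with any prescribed precision. -/
def _root_.IsComputableMap (ι : Q → X) {k : ℕ} (f : (Fin k → X) → X) : Prop :=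
  (∃ ζ : ℕ × ℕ → ℕ × ℕ, Computable ζ ∧
    ∀ (ε : ℕ × ℕ) (x y : Fin k → X),
      dist x y < (posRat (ζ ε) : ℝ) → dist (f x) (f y) < (posRat ε : ℝ)) ∧
  ∃ g : (Fin k → Q) × ℕ → Q, Computable g ∧
    ∀ (a : Fin k → Q) (n : ℕ), dist (f fun i => ι (a i)) (ι (g (a, n))) < (1 / 2 : ℝ) ^ n

/-- `(X, D, Q)` is a computable digit space. -/
structure IsComputableDigitSpace (D : DigitSystem X m) (ι : Q → X) : Prop where
  isDigitSpace : D.IsDigitSpace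
  computableMetric : IsComputableMetric ι
  computable_map : ∀ d, IsComputableMap ι (D.map d)

/-- It is decidable whether a ball with a basic element as centre and a positive rational radius
is contained in the range of a given digit. -/
def IsDecidable (D : DigitSystem X m) (ι : Q → X) : Prop :=
  ∀ d, ComputablePred fun p : Q × (ℕ × ℕ) =>
    Metric.ball (ι p.1) (posRat p.2 : ℝ) ⊆ Set.range (D.map d)

/-- Approximable choice. The procedure `(θ, a) ↦ v (θ, a)` has to be defined only for basic
elements in the interior of the range of the digit; the function `θ ↦ θ'` of the second condition
is `μ`. -/
def HasApproximableChoice (D : DigitSystem X m) (ι : Q → X) : Prop :=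
  ∀ d, ∃ v : (ℕ × ℕ) × Q →. (Fin (D.ar d) → Q), Partrec v ∧
    (∀ (θ : ℕ × ℕ) (a : Q), ι a ∈ interior (Set.range (D.map d)) → (v (θ, a)).Dom) ∧
    (∀ (θ θ₁ : ℕ × ℕ) (a : Q), ι a ∈ interior (Set.range (D.map d)) →
      ∀ b ∈ v (θ, a), ∀ c ∈ v (θ₁, a),
        dist (fun i => ι (b i)) (fun i => ι (c i)) < max (posRat θ : ℝ) (posRat θ₁ : ℝ)) ∧
    (∃ μ : ℕ × ℕ → ℕ × ℕ, Computable μ ∧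
      ∀ (θ : ℕ × ℕ) (a a' : Q), ι a ∈ interior (Set.range (D.map d)) →
        ι a' ∈ interior (Set.range (D.map d)) →
        dist (ι a) (ι a') < (posRat (μ θ) : ℝ) →
        ∀ b ∈ v (θ, a), ∀ c ∈ v (θ, a'),
          dist (fun i => ι (b i)) (fun i => ι (c i)) < (posRat θ : ℝ)) ∧
    (∀ (θ : ℕ × ℕ) (a : Q), ι a ∈ interior (Set.range (D.map d)) →
      ∀ b ∈ v (θ, a), ∃ y : Fin (D.ar d) → X,
        D.map d y = ι a ∧ dist y (fun i => ι (b i)) < (posRat θ : ℝ))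

end Computability

end DigitSystem

/-! ### Type-two computability and representations -/

/-- Let the elements of `A` and `B` be named by infinite sequences of finite objects. A partial
operator `H` from `A` to `B` is computable if there is a computable `φ` which, from a finite
prefix of the name of `a` in the domain of `H`, and `n`, produces nothing or the `n`-th term of the
name of `H a`, and does produce the latter from some sufficiently long prefix. -/
def IsComputableOperator {A B : Type*} {α β : Type*} [Primcodable α] [Primcodable β]
    (nameA : A → ℕ → α) (nameB : B → ℕ → β) (H : A →. B) : Prop :=
  ∃ φ : List α × ℕ → Option β, Computable φ ∧
    ∀ (a : A) (b : B), b ∈ H a → ∀ n : ℕ,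
      (∃ k, φ ((List.range k).map (nameA a), n) = some (nameB b n)) ∧
      ∀ k y, φ ((List.range k).map (nameA a), n) = some y → y = nameB b n

/-- Reducibility of representations of `X`: names with respect to `δ` can computably be translated
into names, with respect to `γ`, of the same point. -/
def RepReducible {X α β : Type*} [Primcodable α] [Primcodable β]
    (δ : (ℕ → α) →. X) (γ : (ℕ → β) →. X) : Prop :=
  ∃ H : (ℕ → α) →. (ℕ → β), IsComputableOperator id id H ∧
    ∀ p, ∀ x ∈ δ p, ∃ p' ∈ H p, x ∈ γ p'

/-- Computable equivalence of representations. -/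
def RepEquiv {X α β : Type*} [Primcodable α] [Primcodable β]
    (δ : (ℕ → α) →. X) (γ : (ℕ → β) →. X) : Prop :=
  RepReducible δ γ ∧ RepReducible γ δ

/-- The Cauchy representation `ρ_C`: the sequence `w` of basic elements denotes the (unique) point
`x` with `ρ(x, w_n) < 2^{-n}` for all `n`, if there is one. -/
noncomputable def cauchyRep {X : Type u} [MetricSpace X] {Q : Type v} (ι : Q → X) :
    (ℕ → Q) →. X :=
  fun w => ⟨∃ x, ∀ n : ℕ, dist x (ι (w n)) < (1 / 2 : ℝ) ^ n, fun h => h.choose⟩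

/-- The tree representation: the stream `T^(0) : T^(1) : ⋯` denotes `⟦T⟧`. -/
noncomputable def treeRep {X : Type u} [MetricSpace X] {m : ℕ} {D : DigitSystem X m}
    (h : D.IsDigitSpace) : (ℕ → List (List ℕ × Fin m)) →. X :=
  fun p => ⟨∃ T : InfTree D.ar, T.stream = p, fun hp => h.val hp.choose⟩

/-! From trees to names: if `T` has root label `d` and immediate subtrees `T_i`, then `⟦T⟧ =
d(⟦T_1⟧, …)`. Replace the subtrees at depth `J` by one basic element and evaluate the digits above
them up to `2^{-p}`. With a common contraction factor `q` and a bound `M` on all distances, the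
error is at most `q^J M + J 2^{-p}` (`dist_evalApprox_le`), and `J` and `p` can be computed from the
required precision (`exists_treeToName`).

From names to trees: by compactness, well-covering has a Lebesgue number, so one fixed term of a
name of `x` is precise enough to decide on a digit `d` whose range is a neighbourhood of `x`
(`exists_computable_digit`). Approximable choice then yields names of the components of some `y`
with `d(y) = x` (`exists_preimage_name`). Repeating this at each component labels the nodes of a
tree; `x` lies in the range of every initial segment, so it is the value of the tree (`val_unfold`).

Both procedures recurse over nodes and need sufficiently long prefixes of their input. The programs
come from the recursion theorem (`Partrec.exists_run_eq`). `Approximates` records that runs on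
prefixes never err and eventually succeed, and `IsComputableOperator.of_approximates` turns this
into a total function on prefixes. -/

/-! ### Partial recursive functions -/

/-- The list of the results of `f 0, …, f (n - 1)`. -/
def Part.listRange {σ : Type*} (f : ℕ → Part σ) (n : ℕ) : Part (List σ) :=
  Nat.rec (Part.some []) (fun i l => l.bind fun l => (f i).map fun y => l ++ [y]) n

theorem Part.listRange_succ {σ : Type*} (f : ℕ → Part σ) (n : ℕ) :
    Part.listRange f (n + 1) =
      (Part.listRange f n).bind fun l => (f n).map fun y => l ++ [y] := rfl

section Recursion

open Nat.Partrec (Code)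
open Encodable

variable {α : Type*} {σ : Type*} [Primcodable α] [Primcodable σ]

/-- The partial function between coded types that is computed by a program. -/
def Nat.Partrec.Code.run (σ : Type*) [Primcodable σ] (c : Code) (a : α) : Part σ :=
  (c.eval (encode a)).bind fun n => (decode n : Option σ)

theorem Nat.Partrec.Code.partrec_run :
    Partrec fun p : Code × α => Code.run σ p.1 p.2 :=
  (Code.eval_part.comp Computable.fst (Computable.encode.comp Computable.snd)).bind
    (Computable.ofOption (Computable.decode.comp Computable.snd)).to₂

theorem Partrec.exists_code_run {f : α →. σ} (hf : Partrec f) :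
    ∃ c : Code, ∀ a, c.run σ a = f a := by
  obtain ⟨c, hc⟩ := Code.exists_code.1 hf
  refine ⟨c, fun a => ?_⟩
  simp [Code.run, hc, Part.bind_map]

/-- Definition of a partial recursive function by general recursion. -/
theorem Partrec.exists_run_eq {f : Code × α →. σ} (hf : Partrec f) :
    ∃ c : Code, ∀ a, c.run σ a = f (c, a) := by
  have h : Partrec₂ fun (c : Code) (n : ℕ) =>
      (Part.ofOption (decode n : Option α)).bind fun a => (f (c, a)).map encode :=
    (Computable.ofOption (Computable.decode.comp Computable.snd)).bind
      (((hf.comp ((Computable.fst.comp Computable.fst).pair Computable.snd)).map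
        (Computable.encode.comp Computable.snd).to₂).to₂)
  -- Kleene's second recursion theorem: `c` receives its own code as the first argument of `f`.
  obtain ⟨c, hc⟩ := Code.fixed_point₂ h
  refine ⟨c, fun a => ?_⟩
  simp [Code.run, hc, Part.bind_map]

/-- Every map from a finite type to programs is computable, so programs chosen separately for each
`b` combine into a single one. This gives uniformity in the digit. -/
theorem Partrec.uncurry_finite {β : Type*} [Primcodable β] [Finite β] {f : β → α →. σ}
    (hf : ∀ b, Partrec (f b)) : Partrec fun p : β × α => f p.1 p.2 := by
  choose c hc using fun b => (hf b).exists_code_run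
  refine (Code.partrec_run.comp
    (((Primrec.dom_finite c).to_comp.comp Computable.fst).pair Computable.snd)).of_eq ?_
  exact fun p => hc p.1 p.2

theorem Computable.uncurry_finite {β : Type*} [Primcodable β] [Finite β] {f : β → α → σ}
    (hf : ∀ b, Computable (f b)) : Computable fun p : β × α => f p.1 p.2 :=
  Partrec.uncurry_finite (f := fun b a => Part.some (f b a)) hf

/-- Computable selection of an element with a decidable property. -/
theorem ComputablePred.exists_computable_choice {β : Type*} [Primcodable β] {P : β × α → Prop}
    (hP : ComputablePred P) (h : ∀ a, ∃ b, P (b, a)) :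
    ∃ f : α → β, Computable f ∧ ∀ a, P (f a, a) := by
  obtain ⟨_, hd⟩ := hP
  let g : α → ℕ → Option β := fun a n =>
    (decode n : Option β).bind fun b => bif decide (P (b, a)) then some b else none
  have hg : Computable₂ g :=
    Computable.option_bind (Computable.decode.comp Computable.snd)
      (Computable.cond (hd.comp (Computable.snd.pair (Computable.fst.comp Computable.fst)))
        (Computable.option_some.comp Computable.snd) (Computable.const none)).to₂
  have hdom : ∀ a, (Nat.rfindOpt (g a)).Dom := by
    intro a
    obtain ⟨b, hb⟩ := h a
    exact Nat.rfindOpt_dom.2 ⟨encode b, b, by simp [g, hb]⟩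
  refine ⟨fun a => (Nat.rfindOpt (g a)).get (hdom a),
    (Partrec.rfindOpt hg).of_eq_tot fun a => Part.get_mem _, fun a => ?_⟩
  obtain ⟨n, hn⟩ := Nat.rfindOpt_spec (Part.get_mem (hdom a))
  obtain ⟨b, hb, hb'⟩ := Option.bind_eq_some_iff.1 hn
  by_cases hP : P (b, a)
  · simp only [hP, decide_true, cond_true, Option.some.injEq] at hb'
    simpa only [← hb'] using hP
  · simp [hP] at hb'

theorem Partrec.listRange {f : α → ℕ →. σ} {n : α → ℕ} (hf : Partrec₂ f) (hn : Computable n) :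
    Partrec fun a => Part.listRange (f a) (n a) := by
  refine Partrec.nat_rec hn (Computable.const []).partrec (h := fun a p =>
    (f a p.1).map fun y => p.2 ++ [y]) ?_
  refine Partrec.map (hf.comp Computable.fst (Computable.fst.comp Computable.snd)) ?_
  exact Computable.list_concat.comp
    (Computable.snd.comp (Computable.snd.comp Computable.fst)) Computable.snd

theorem Computable.list_ofFn_app {k : ℕ} : Computable (List.ofFn : (Fin k → σ) → List σ) :=
  (Computable.list_ofFn (f := fun i (a : Fin k → σ) => a i) fun i =>
    Computable.fin_app.comp Computable.id (Computable.const i))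

theorem Computable.list_getD_fin {k : ℕ} (y : σ) :
    Computable fun (l : List σ) (i : Fin k) => l.getD i y :=
  (Primrec.fin_curry.2 (((Primrec.list_getD y).comp Primrec.fst
    (Primrec.fin_val.comp Primrec.snd)).to₂ (f := fun p : List σ × Fin k => p.1.getD p.2 y))).to_comp

end Recursion

/-! ### Computations on longer and longer prefixes -/

section Approximation

open Filter

variable {σ τ : Type*}

/-- The results of a computation on the prefixes of a sequence: none of them, if defined, differs
from `y`, and all but finitely many are defined. -/
def Approximates (p : ℕ → Part σ) (y : σ) : Prop :=
  (∀ k, ∀ z ∈ p k, z = y) ∧ ∀ᶠ k in atTop, y ∈ p k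

theorem Approximates.of_mem {p : Part σ} {y : σ} (h : y ∈ p) : Approximates (fun _ => p) y :=
  ⟨fun _ _ hz => Part.mem_unique hz h, Eventually.of_forall fun _ => h⟩

/-- The first computation yields `y` or nothing, so the second needs to be controlled at `y` only;
two cofinite sets of prefix lengths intersect in a cofinite one. -/
theorem Approximates.bind {p : ℕ → Part σ} {y : σ} {f : ℕ → σ → Part τ} {z : τ}
    (hp : Approximates p y) (hf : Approximates (fun k => f k y) z) :
    Approximates (fun k => (p k).bind (f k)) z := by
  constructor
  · intro k t ht
    obtain ⟨s, hs, ht⟩ := Part.mem_bind_iff.1 ht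
    obtain rfl := hp.1 k s hs
    exact hf.1 k t ht
  · filter_upwards [hp.2, hf.2] with k h₁ h₂
    exact Part.mem_bind h₁ h₂

theorem Approximates.map {p : ℕ → Part σ} {y : σ} (hp : Approximates p y) (f : σ → τ) :
    Approximates (fun k => (p k).map f) (f y) := by
  constructor
  · intro k t ht
    obtain ⟨s, hs, rfl⟩ := (Part.mem_map_iff _).1 ht
    rw [hp.1 k s hs]
  · filter_upwards [hp.2] with k h
    exact Part.mem_map f h

theorem Approximates.listRange {f : ℕ → ℕ → Part σ} {y : ℕ → σ} {n : ℕ}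
    (h : ∀ i < n, Approximates (fun k => f k i) (y i)) :
    Approximates (fun k => Part.listRange (f k) n) ((List.range n).map y) := by
  induction n with
  | zero => exact .of_mem (Part.mem_some _)
  | succ n ih =>
    simp only [Part.listRange_succ, List.range_succ, List.map_append, List.map_singleton]
    exact (ih fun i hi => h i (hi.trans n.lt_succ_self)).bind ((h n n.lt_succ_self).map _)

theorem Approximates.getElem? (w : ℕ → σ) (n : ℕ) :
    Approximates (fun k => (((List.range k).map w)[n]? : Part σ)) (w n) := by
  constructor
  · intro k z hz
    have := Part.mem_ofOption.1 hz
    simp only [List.getElem?_map, Option.mem_def, Option.map_eq_some_iff,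
      List.getElem?_eq_some_iff] at this
    obtain ⟨_, ⟨hn, rfl⟩, rfl⟩ := this
    simp
  · filter_upwards [eventually_gt_atTop n] with k hk
    exact Part.mem_ofOption.2 (by simp [hk])

open Encodable in
/-- An operator is computable if its values can be computed by a partial recursive function of
sufficiently long prefixes of names. -/
theorem IsComputableOperator.of_approximates {A B α β : Type*} [Primcodable α] [Primcodable β]
    {nameA : A → ℕ → α} {nameB : B → ℕ → β} {H : A →. B} {ψ : List α × ℕ →. β}
    (hψ : Partrec ψ)
    (h : ∀ a, ∀ b ∈ H a, ∀ n,
      Approximates (fun k => ψ ((List.range k).map (nameA a), n)) (nameB b n)) :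
    IsComputableOperator nameA nameB H := by
  obtain ⟨c, hc⟩ := Nat.Partrec.Code.exists_code.1 hψ
  have hc' : ∀ l n y, encode y ∈ c.eval (encode (l, n)) ↔ y ∈ ψ (l, n) := by
    intro l n y
    simp [hc]
  -- A prefix whose length codes `(j, t)` is used as follows: evaluate on its first `j` terms with
  -- resource bound `t`. Since `j ≤ Nat.pair j t`, these terms are available, and every pair is the
  -- code of some length.
  let φ : List α × ℕ → Option β := fun p =>
    (Nat.Partrec.Code.evaln p.1.length.unpair.2 c
      (encode (p.1.take p.1.length.unpair.1, p.2))).bind decode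
  have hlen : Primrec fun p : List α × ℕ => p.1.length.unpair :=
    Primrec.unpair.comp (Primrec.list_length.comp Primrec.fst)
  have hφ : Primrec φ := by
    refine Primrec.option_bind (Nat.Partrec.Code.primrec_evaln.comp
      (Primrec.pair (Primrec.pair (Primrec.snd.comp hlen) (Primrec.const c))
        (Primrec.encode.comp (Primrec.pair
          (Primrec.list_take.comp (Primrec.fst.comp hlen) Primrec.fst) Primrec.snd))))
      (Primrec.decode.comp Primrec.snd).to₂
  refine ⟨φ, hφ.to_comp, fun a b hb n => ?_⟩
  obtain ⟨h₁, h₂⟩ := h a b hb n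
  have htake : ∀ k j, j ≤ k →
      ((List.range k).map (nameA a)).take j = (List.range j).map (nameA a) := by
    intro k j hjk
    rw [← List.map_take, List.take_range, min_eq_left hjk]
  constructor
  · obtain ⟨j, hj⟩ := h₂.exists
    obtain ⟨t, ht⟩ := Nat.Partrec.Code.evaln_complete.1 ((hc' _ _ _).2 hj)
    refine ⟨Nat.pair j t, ?_⟩
    simp only [φ, List.length_map, List.length_range, Nat.unpair_pair]
    rw [htake _ _ (Nat.left_le_pair j t), Option.mem_def.1 ht]
    simp
  · intro k y hy
    simp only [φ, List.length_map, List.length_range] at hy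
    rw [htake _ _ (Nat.unpair_left_le k)] at hy
    obtain ⟨e, he, hy⟩ := Option.bind_eq_some_iff.1 hy
    have := Nat.Partrec.Code.evaln_sound he
    rw [hc] at this
    simp only [encodek, Part.coe_some, Part.bind_some, Part.mem_map_iff] at this
    obtain ⟨z, hz, rfl⟩ := this
    rw [encodek, Option.some.injEq] at hy
    rw [← hy]
    exact h₁ _ _ hz

end Approximation

/-! ### Infinite trees -/

theorem List.ofFn_val {α : Type*} (n : ℕ) (f : ℕ → α) :
    List.ofFn (fun i : Fin n => f i) = (List.range n).map f :=
  List.ext_getElem (by simp) (by simp)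

namespace InfTree

variable {m : ℕ} {ar : Fin m → ℕ}

/-- `mem_snoc` governs the last letter of a word, while subtrees concern the first one; removing
letters from the end leads back to the one-letter word. -/
theorem lt_ar_root_of_label_cons (T : InfTree ar) {i : ℕ} {s : List ℕ}
    (h : (T.label (i :: s)).isSome) : i < ar T.root := by
  induction s using List.reverseRecOn with
  | nil =>
    obtain ⟨d, hd, hi⟩ := (T.mem_snoc [] i).1 h
    rw [T.label_nil, Option.some.injEq] at hd
    rwa [hd]
  | append_singleton s j ih =>
    obtain ⟨d, hd, -⟩ := (T.mem_snoc (i :: s) j).1 h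
    exact ih (by simp [hd])

theorem stream_succ (T : InfTree ar) (n : ℕ) :
    T.stream (n + 1) = ([], T.root) :: (List.ofFn fun i : Fin (ar T.root) =>
      ((T.subtree i).stream n).map fun p => ((i : ℕ) :: p.1, p.2)).flatten := by
  simp [stream, init, FinTree.graph]

theorem mem_stream (T : InfTree ar) {n : ℕ} {s : List ℕ} {d : Fin m} :
    (s, d) ∈ T.stream n ↔ s.length ≤ n ∧ T.label s = some d := by
  induction n generalizing T s with
  | zero =>
    simp only [stream, init, FinTree.graph, List.mem_singleton, Prod.mk.injEq, Nat.le_zero,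
      List.length_eq_zero_iff]
    refine and_congr_right ?_
    rintro rfl
    rw [T.label_nil, Option.some.injEq, eq_comm]
  | succ n ih =>
    rw [stream_succ]
    cases s with
    | nil => simp [T.label_nil, eq_comm]
    | cons i s =>
      simp only [List.mem_cons, Prod.mk.injEq, reduceCtorEq, false_and, List.mem_flatten,
        List.mem_ofFn, List.mem_map, Prod.exists, false_or, exists_exists_eq_and, List.cons.injEq,
        List.length_cons, Nat.add_le_add_iff_right]
      constructor
      · rintro ⟨j, s', d', h, ⟨rfl, rfl⟩, rfl⟩
        exact (ih _).1 h
      · rintro ⟨h₁, h₂⟩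
        exact ⟨⟨i, T.lt_ar_root_of_label_cons (Option.isSome_iff_exists.2 ⟨d, h₂⟩)⟩, s, d,
          (ih _).2 ⟨h₁, h₂⟩, ⟨rfl, rfl⟩, rfl⟩

/-- Ensures that the tree chosen in `treeRep` for a stream is the one the stream came from. The
label of `s` is read off at height `s.length`. -/
theorem stream_injective : Function.Injective (stream (ar := ar)) := by
  intro T T' h
  ext s d
  have := (T.mem_stream (n := s.length) (s := s) (d := d)).symm
  rw [h, T'.mem_stream] at this
  simpa using this

/-- The tree generated by a labelling of states and a successor function. -/
def unfoldLabel {S : Type*} (ar : Fin m → ℕ) (lab : S → Fin m) (next : S → ℕ → S) :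
    S → List ℕ → Option (Fin m)
  | s, [] => some (lab s)
  | s, i :: l => if i < ar (lab s) then unfoldLabel ar lab next (next s i) l else none

/-- The tree generated by a labelling of states and a successor function, from a state. -/
def unfold {S : Type*} (ar : Fin m → ℕ) (lab : S → Fin m) (next : S → ℕ → S) (s : S) :
    InfTree ar where
  label := unfoldLabel ar lab next s
  root_mem := rfl
  mem_snoc l j := by
    induction l generalizing s with
    | nil => simp [unfoldLabel]
    | cons i l ih =>
      simp only [List.cons_append, unfoldLabel]
      split_ifs with h
      · exact ih (next s i)
      · simp

variable {S : Type*} (lab : S → Fin m) (next : S → ℕ → S)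

theorem subtree_unfold (s : S) (i : Fin (ar (lab s))) :
    (unfold ar lab next s).subtree i = unfold ar lab next (next s i) := by
  ext1
  funext l
  change unfoldLabel ar lab next s (i :: l) = unfoldLabel ar lab next (next s i) l
  simp [unfoldLabel]

theorem stream_unfold_zero (s : S) : (unfold ar lab next s).stream 0 = [([], lab s)] := rfl

theorem stream_unfold_succ (s : S) (n : ℕ) :
    (unfold ar lab next s).stream (n + 1) = ([], lab s) :: ((List.range (ar (lab s))).map fun i =>
      ((unfold ar lab next (next s i)).stream n).map fun p => (i :: p.1, p.2)).flatten := by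
  rw [stream_succ, ← List.ofFn_val]
  refine congrArg (fun l => _ :: List.flatten l) (congrArg List.ofFn (funext fun i => ?_))
  exact congrArg (fun T => (stream T n).map _) (subtree_unfold lab next s i)

end InfTree

/-! ### Values of trees -/

namespace DigitSystem

variable {X : Type u} {m : ℕ} [MetricSpace X] {D : DigitSystem X m}

theorem IsDigitSpace.val_eq (h : D.IsDigitSpace) {T : InfTree D.ar} {x : X}
    (hx : ∀ n, x ∈ Set.range (D.treeMap (T.init n))) : h.val T = x :=
  (h.existsUnique_value T).unique (h.existsUnique_value T).choose_spec.1 (Set.mem_iInter.2 hx)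

theorem IsDigitSpace.val_mem (h : D.IsDigitSpace) (T : InfTree D.ar) (n : ℕ) :
    h.val T ∈ Set.range (D.treeMap (T.init n)) :=
  Set.mem_iInter.1 (h.existsUnique_value T).choose_spec.1 n

/-- The right-hand side lies in the range of every initial segment of `T`, and only one point does.
-/
theorem IsDigitSpace.val_eq_map (h : D.IsDigitSpace) (T : InfTree D.ar) :
    h.val T = D.map T.root fun i => h.val (T.subtree i) := by
  refine h.val_eq fun n => ?_
  cases n with
  | zero => exact ⟨fun i => h.val (T.subtree i), rfl⟩
  | succ n =>
    rw [InfTree.init, range_treeMap_node]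
    exact ⟨_, fun i _ => h.val_mem _ n, rfl⟩

/-- Approximate evaluation of the initial segments of an infinite tree at the basic element `u`,
by means of a procedure `g` that evaluates the digits approximately. -/
def evalApprox {Q : Type v} {ar : Fin m → ℕ} (g : Fin m × List Q × ℕ → Q) (u : Q) (p : ℕ) :
    ℕ → InfTree ar → Q
  | 0, _ => u
  | j + 1, T => g (T.root, List.ofFn fun i => evalApprox g u p j (T.subtree i), p)

/-- The errors satisfy `e_{j+1} ≤ q e_j + 2^{-p}` and `e_0 ≤ M`. Using only `q ≤ 1` on the
accumulated rounding error gives the bound linear in `j`. -/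
theorem IsDigitSpace.dist_evalApprox_le {Q : Type v} (h : D.IsDigitSpace) {ι : Q → X}
    {q : NNReal} (hq1 : q ≤ 1) (hq : ∀ d, LipschitzWith q (D.map d)) {M : ℝ}
    (hM : ∀ x y : X, dist x y ≤ M) {g : Fin m × List Q × ℕ → Q} {u : Q}
    (hg : ∀ d l p, dist (D.map d fun i => ι (l.getD i u)) (ι (g (d, l, p))) ≤ (1 / 2 : ℝ) ^ p)
    (p j : ℕ) (T : InfTree D.ar) :
    dist (h.val T) (ι (evalApprox g u p j T)) ≤ q ^ j * M + j * (1 / 2 : ℝ) ^ p := by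
  have hM0 : 0 ≤ M := dist_nonneg.trans (hM (h.val T) (h.val T))
  induction j generalizing T with
  | zero => simpa using hM _ _
  | succ j ih =>
    have h₁ : dist (h.val T) (D.map T.root fun i => ι (evalApprox g u p j (T.subtree i))) ≤
        q * (q ^ j * M + j * (1 / 2 : ℝ) ^ p) := by
      rw [h.val_eq_map T]
      refine ((hq _).dist_le_mul _ _).trans (mul_le_mul_of_nonneg_left ?_ q.2)
      exact (dist_pi_le_iff (by positivity)).2 fun i => ih _
    have h₂ := hg T.root (List.ofFn fun i => evalApprox g u p j (T.subtree i)) p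
    have h₃ : (fun i : Fin (D.ar T.root) =>
        ι ((List.ofFn fun i => evalApprox g u p j (T.subtree i)).getD i u)) =
        fun i => ι (evalApprox g u p j (T.subtree i)) := by
      funext i
      simp
    rw [h₃] at h₂
    have h₄ : (q : ℝ) * (j * (1 / 2 : ℝ) ^ p) ≤ j * (1 / 2 : ℝ) ^ p :=
      mul_le_of_le_one_left (by positivity) (by exact_mod_cast hq1)
    refine (dist_triangle _ _ _).trans ((add_le_add h₁ h₂).trans ?_)
    push_cast
    rw [pow_succ']
    linarith

end DigitSystem

/-! ### Evaluation of trees is computable -/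

section Evaluation

open Nat.Partrec (Code)

variable {m : ℕ}

/-- The label of a node in a finite tree that is given by the list of its nodes. -/
def lookupLabel (L : List (List ℕ × Fin m)) (s : List ℕ) : Part (Fin m) :=
  Nat.rfindOpt fun j => L[j]?.bind fun q => if q.1 = s then some q.2 else none

theorem partrec_lookupLabel :
    Partrec₂ (lookupLabel : List (List ℕ × Fin m) → List ℕ → Part (Fin m)) := by
  refine Partrec.rfindOpt (Primrec.option_bind (Primrec.list_getElem?.comp
    (Primrec.fst.comp Primrec.fst) Primrec.snd) ?_).to_comp
  exact Primrec.ite (Primrec.eq.comp (Primrec.fst.comp Primrec.snd)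
    (Primrec.snd.comp (Primrec.fst.comp Primrec.fst)))
    (Primrec.option_some.comp (Primrec.snd.comp Primrec.snd)) (Primrec.const none)

/-- Whichever entry for `s` the search meets first, it carries the label of `s` in `T`. -/
theorem mem_lookupLabel_stream {ar : Fin m → ℕ} (T : InfTree ar) {n : ℕ} {s : List ℕ} {d : Fin m}
    (hs : s.length ≤ n) (hd : T.label s = some d) : d ∈ lookupLabel (T.stream n) s := by
  obtain ⟨j, hj⟩ := List.mem_iff_getElem?.1 (T.mem_stream.2 ⟨hs, hd⟩)
  have hdom : (lookupLabel (T.stream n) s).Dom := Nat.rfindOpt_dom.2 ⟨j, d, by simp [hj]⟩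
  obtain ⟨k, hk⟩ := Nat.rfindOpt_spec (Part.get_mem hdom)
  obtain ⟨⟨s', d'⟩, hk₁, hk₂⟩ := Option.bind_eq_some_iff.1 hk
  split_ifs at hk₂ with hs'
  obtain rfl : s' = s := hs'
  have := (T.mem_stream.1 (List.mem_of_getElem? hk₁)).2
  rw [hd, Option.some.injEq] at this
  rw [this, show d' = _ from Option.some.inj hk₂]
  exact Part.get_mem hdom

/-- One unfolding of the recursion for `evalApprox`, with `R` in place of the recursive calls, as
the recursion theorem requires. Paths are kept reversed, so that passing to a child is a `cons`. -/
theorem partrec_evalApprox_aux {Q : Type v} [Primcodable Q] (ar : Fin m → ℕ)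
    {g : Fin m × List Q × ℕ → Q} (hg : Computable g) (u : Q) {γ : Type*} [Primcodable γ]
    {R : γ × ((List (List ℕ × Fin m) × ℕ) × List ℕ × ℕ) →. Q} (hR : Partrec R) :
    Partrec fun a : γ × ((List (List ℕ × Fin m) × ℕ) × List ℕ × ℕ) =>
      (Nat.casesOn a.2.2.2 (Part.some u) fun j =>
        (lookupLabel a.2.1.1 a.2.2.1.reverse).bind fun d =>
          (Part.listRange (fun i => R (a.1, a.2.1, i :: a.2.2.1, j)) (ar d)).map fun l =>
            g (d, l, a.2.1.2) : Part Q) := by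
  refine Partrec.nat_casesOn_right (Computable.snd.comp (Computable.snd.comp Computable.snd))
    (Computable.const u) ?_
  have h₁ : Computable fun b : (γ × (List (List ℕ × Fin m) × ℕ) × List ℕ × ℕ) × ℕ =>
      b.1.2.1 := Computable.fst.comp (Computable.snd.comp Computable.fst)
  have h₂ : Computable fun b : (γ × (List (List ℕ × Fin m) × ℕ) × List ℕ × ℕ) × ℕ =>
      b.1.2.2.1 :=
    Computable.fst.comp (Computable.snd.comp (Computable.snd.comp Computable.fst))
  have h₃ : Computable fun b : ((γ × (List (List ℕ × Fin m) × ℕ) × List ℕ × ℕ) × ℕ) ×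
      Fin m => ar b.2 := (Primrec.dom_finite ar).to_comp.comp Computable.snd
  have h₄ : Partrec₂ fun (b : ((γ × (List (List ℕ × Fin m) × ℕ) × List ℕ × ℕ) × ℕ) × Fin m)
      (i : ℕ) => R (b.1.1.1, b.1.1.2.1, i :: b.1.1.2.2.1, b.1.2) :=
    hR.comp (((Computable.fst.comp Computable.fst).comp
      (Computable.fst.comp Computable.fst)).pair
      ((h₁.comp (Computable.fst.comp Computable.fst)).pair
        ((Computable.list_cons.comp Computable.snd
          (h₂.comp (Computable.fst.comp Computable.fst))).pair
        (Computable.snd.comp (Computable.fst.comp Computable.fst)))))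
  have h₅ : Computable₂ fun (b : ((γ × (List (List ℕ × Fin m) × ℕ) × List ℕ × ℕ) × ℕ) ×
      Fin m) (l : List Q) => g (b.2, l, b.1.1.2.1.2) :=
    hg.comp ((Computable.snd.comp Computable.fst).pair (Computable.snd.pair
      (Computable.snd.comp (h₁.comp (Computable.fst.comp Computable.fst)))))
  exact (partrec_lookupLabel.comp (Computable.fst.comp h₁)
    (Computable.list_reverse.comp h₂)).bind ((Partrec.listRange h₄ h₃).map h₅).to₂

theorem exists_partrec_evalApprox {Q : Type v} [Primcodable Q] (ar : Fin m → ℕ)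
    {g : Fin m × List Q × ℕ → Q} (hg : Computable g) (u : Q) :
    ∃ E : (List (List ℕ × Fin m) × ℕ) × ℕ →. Q, Partrec E ∧ ∀ (T : InfTree ar) (n p : ℕ),
      DigitSystem.evalApprox g u p n T ∈ E ((T.stream n, p), n) := by
  obtain ⟨c, hc⟩ := (partrec_evalApprox_aux ar hg u
    (Code.partrec_run (α := (List (List ℕ × Fin m) × ℕ) × List ℕ × ℕ))).exists_run_eq
  refine ⟨fun a => c.run Q (a.1, ([] : List ℕ), a.2), Code.partrec_run.comp
    ((Computable.const c).pair (Computable.fst.pair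
      ((Computable.const []).pair Computable.snd))), fun T n p => ?_⟩
  -- Invariant: `T'` is the subtree of `T` at the node `r.reverse`, and the depth already reached
  -- plus the height still to be evaluated stays within the given segment of height `n`.
  have key : ∀ (j : ℕ) (r : List ℕ) (T' : InfTree ar),
      (∀ s, T'.label s = T.label (r.reverse ++ s)) → r.length + j ≤ n →
      DigitSystem.evalApprox g u p j T' ∈ c.run Q ((T.stream n, p), r, j) := by
    intro j
    induction j with
    | zero =>
      intro r T' _ _
      rw [hc]
      exact Part.mem_some _
    | succ j ih =>
      intro r T' hT' hr
      rw [hc]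
      refine Part.mem_bind (mem_lookupLabel_stream T (d := T'.root) (by simp; omega) ?_) ?_
      · rw [← T'.label_nil, hT', List.append_nil]
      have happ := Approximates.listRange (n := ar T'.root)
        (f := fun _ i => c.run Q ((T.stream n, p), i :: r, j))
        (y := fun i => if h : i < ar T'.root then
          DigitSystem.evalApprox g u p j (T'.subtree ⟨i, h⟩) else u) (by
          intro i hi
          rw [dif_pos hi]
          refine .of_mem (ih _ _ (fun s => ?_) (by simp; omega))
          change T'.label (i :: s) = _
          rw [hT']
          simp)
      obtain ⟨_, hk⟩ := happ.2.exists
      have := Part.mem_map (fun l => g (T'.root, l, p)) hk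
      rw [← List.ofFn_val] at this
      simpa [DigitSystem.evalApprox] using this
  exact key n [] T (fun _ => rfl) (by simp)

end Evaluation

/-! ### Names of points -/

section Names

variable {X : Type u} [MetricSpace X] {Q : Type v}

/-- The sequence `w` of basic elements converges to `x` at the rate that the Cauchy representation
prescribes. -/
def IsCauchyName (ι : Q → X) (w : ℕ → Q) (x : X) : Prop :=
  ∀ n : ℕ, dist x (ι (w n)) < (1 / 2 : ℝ) ^ n

theorem IsCauchyName.dist_lt {ι : Q → X} {w : ℕ → Q} {x : X} (h : IsCauchyName ι w x) {j k : ℕ}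
    (hjk : j ≤ k) : dist (ι (w j)) (ι (w k)) < 2 * (1 / 2 : ℝ) ^ j := by
  have h₁ : (1 / 2 : ℝ) ^ k ≤ (1 / 2) ^ j :=
    pow_le_pow_of_le_one (by norm_num) (by norm_num) hjk
  have := dist_triangle_left (ι (w j)) (ι (w k)) x
  linarith [h j, h k]

theorem IsCauchyName.unique {ι : Q → X} {w : ℕ → Q} {x y : X} (hx : IsCauchyName ι w x)
    (hy : IsCauchyName ι w y) : x = y := by
  have hlim : Filter.Tendsto (fun n : ℕ => 2 * (1 / 2 : ℝ) ^ n) Filter.atTop (nhds 0) := by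
    simpa using (tendsto_pow_atTop_nhds_zero_of_lt_one (r := (1 / 2 : ℝ))
      (by norm_num) (by norm_num)).const_mul 2
  refine dist_le_zero.1 (ge_of_tendsto' hlim fun n => ?_)
  linarith [dist_triangle_right x y (ι (w n)), hx n, hy n]

theorem IsCauchyName.cauchyRep_eq {ι : Q → X} {w : ℕ → Q} {x : X} (h : IsCauchyName ι w x) :
    cauchyRep ι w = Part.some x := by
  have hdom : (cauchyRep ι w).Dom := ⟨x, h⟩
  refine Part.eq_some_iff.2 ⟨hdom, ?_⟩
  exact IsCauchyName.unique (Exists.choose_spec hdom) h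

theorem isCauchyName_of_mem_cauchyRep {ι : Q → X} {w : ℕ → Q} {x : X} (h : x ∈ cauchyRep ι w) :
    IsCauchyName ι w x := by
  obtain ⟨hdom, rfl⟩ := h
  exact Exists.choose_spec hdom

/-- `(a + 1)/(b + 1) ≥ 1/(b + 1) > 2^{-(b+1)}`. With `IsCauchyName.dist_lt`, this reads off from a
rational code the index from which on the terms of a name are that close. -/
theorem two_mul_half_pow_add_two_lt_posRat (c : ℕ × ℕ) {k : ℕ} (hk : c.2 + 2 ≤ k) :
    2 * (1 / 2 : ℝ) ^ k < (posRat c : ℝ) := by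
  have h₁ : (1 / 2 : ℝ) ^ k ≤ (1 / 2) ^ (c.2 + 2) :=
    pow_le_pow_of_le_one (by norm_num) (by norm_num) hk
  have h₂ : ((c.2 + 1 : ℕ) : ℝ) < 2 ^ (c.2 + 1) := by exact_mod_cast Nat.lt_two_pow_self
  have h₃ : 2 * (1 / 2 : ℝ) ^ (c.2 + 2) = 1 / 2 ^ (c.2 + 1) := by
    rw [one_div_pow, pow_succ 2 (c.2 + 1)]
    field_simp
  have h₄ : (1 : ℝ) / 2 ^ (c.2 + 1) < 1 / (c.2 + 1 : ℕ) :=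
    one_div_lt_one_div_of_lt (by positivity) h₂
  have h₅ : (1 : ℝ) / (c.2 + 1 : ℕ) ≤ (posRat c : ℝ) := by
    simp only [posRat]
    push_cast
    gcongr
    linarith [(Nat.cast_nonneg c.1 : (0 : ℝ) ≤ c.1)]
  linarith

theorem posRat_two_pow_lt (n : ℕ) : 2 * (posRat (0, 2 ^ (n + 1)) : ℝ) < (1 / 2 : ℝ) ^ n := by
  simp only [posRat]
  push_cast
  rw [one_div_pow, mul_div_assoc', div_lt_div_iff₀ (by positivity) (by positivity), pow_succ]
  linarith

theorem posRat_two_pow_antitone {j k : ℕ} (h : j ≤ k) :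
    (posRat (0, 2 ^ (k + 1)) : ℝ) ≤ (posRat (0, 2 ^ (j + 1)) : ℝ) := by
  simp only [posRat]
  push_cast
  gcongr
  norm_num

end Names

/-! ### Digits, preimages and values of trees in terms of Cauchy names -/

namespace DigitSystem

variable {X : Type u} {m : ℕ} [MetricSpace X] {D : DigitSystem X m} {Q : Type v} [Primcodable Q]
  {ι : Q → X}

theorem IsComputableDigitSpace.nonempty_basic (hD : D.IsComputableDigitSpace ι) : Nonempty Q :=
  have := hD.isDigitSpace.nonempty
  hD.computableMetric.dense.nonempty

/-- A digit whose range is a neighbourhood of a point can be computed from a fixed term of any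
name of the point. -/
theorem exists_computable_digit (hcomp : CompactSpace X) (hcov : D.WellCovering)
    (hdec : D.IsDecidable ι) :
    ∃ (dig : Q → Fin m) (k₀ : ℕ), Computable dig ∧ ∀ w x, IsCauchyName ι w x →
      ∀ k ≥ k₀, ι (w k) ∈ interior (Set.range (D.map (dig (w k₀)))) := by
  -- A Lebesgue number makes one radius `1/(b + 1)` suffice at all points, so the search below
  -- always succeeds and one index `k₀ = b + 2` serves all names.
  obtain ⟨δ, hδ, hball⟩ := lebesgue_number_lemma_of_metric (isCompact_univ (X := X))
    (fun d => isOpen_interior (s := Set.range (D.map d)))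
    (fun x _ => Set.mem_iUnion.2 (hcov x))
  obtain ⟨b, hb⟩ := exists_nat_one_div_lt hδ
  have hpos : (posRat (0, b) : ℝ) < δ := by simpa [posRat] using hb
  choose t ht htP using fun d => ComputablePred.computable_iff.1 (hdec d)
  have hP : ComputablePred fun p : Fin m × Q =>
      Metric.ball (ι p.2) (posRat (0, b) : ℝ) ⊆ Set.range (D.map p.1) := by
    refine ComputablePred.computable_iff.2 ⟨fun p => t p.1 (p.2, (0, b)), ?_, ?_⟩
    · exact Computable.uncurry_finite fun d =>
        (ht d).comp (Computable.id.pair (Computable.const (0, b)))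
    · funext p
      exact congrFun (htP p.1) (p.2, (0, b))
  obtain ⟨dig, hdig, hdigP⟩ := hP.exists_computable_choice fun a => by
    obtain ⟨d, hd⟩ := hball (ι a) (Set.mem_univ _)
    exact ⟨d, (Metric.ball_subset_ball hpos.le).trans (hd.trans interior_subset)⟩
  refine ⟨dig, b + 2, hdig, fun w x hw k hk => ?_⟩
  refine interior_maximal (hdigP (w (b + 2))) Metric.isOpen_ball ?_
  rw [Metric.mem_ball']
  exact (hw.dist_lt hk).trans (two_mul_half_pow_add_two_lt_posRat (0, b) le_rfl)

/-- From a name of a point near which a digit is onto, names of the components of a preimage can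
be computed. -/
theorem HasApproximableChoice.exists_preimage_name (h : D.IsDigitSpace)
    (hch : D.HasApproximableChoice ι) (k₀ : ℕ) (d : Fin m) :
    ∃ (V : ℕ × Q →. (Fin (D.ar d) → Q)) (K : ℕ → ℕ), Partrec V ∧ Computable K ∧
      ∀ w x, IsCauchyName ι w x →
        (∀ k ≥ k₀, ι (w k) ∈ interior (Set.range (D.map d))) →
        (∀ n, (V (n, w (K n))).Dom) ∧ ∃ y, D.map d y = x ∧
          ∀ n, ∀ b ∈ V (n, w (K n)), ∀ i, dist (y i) (ι (b i)) < (1 / 2 : ℝ) ^ n := by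
  have := h.compact
  obtain ⟨v, hv, hdom, hθ, ⟨μ, hμ, hμv⟩, hy⟩ := hch d
  let θ : ℕ → ℕ × ℕ := fun n => (0, 2 ^ (n + 1))
  have hθc : Computable θ := ((Primrec.const 0).pair ((Primrec₂.unpaired'.1 Nat.Primrec.pow).comp
    (Primrec.const 2) Primrec.succ)).to_comp
  let κ : ℕ → ℕ := fun n => (μ (θ n)).2 + 2
  have hκ : Computable κ :=
    (Primrec.nat_add.to_comp.comp (Computable.snd.comp (hμ.comp hθc)) (Computable.const 2))
  -- Summing the `κ j` makes `K` monotone and at least `k₀` (terms in the interior), `κ n`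
  -- (closeness required by `μ`) and `n` (convergence to `x`); the last uses the summand `2` in `κ`.
  let K : ℕ → ℕ := fun n => Nat.rec (k₀ + κ 0) (fun j k => k + κ (j + 1)) n
  have hKs : ∀ n, K (n + 1) = K n + κ (n + 1) := fun n => rfl
  have hKc : Computable K := by
    refine Computable.nat_rec Computable.id (Computable.const (k₀ + κ 0))
      (h := fun _ p => p.2 + κ (p.1 + 1)) ?_
    exact Primrec.nat_add.to_comp.comp (Computable.snd.comp Computable.snd)
      (hκ.comp (Computable.succ.comp (Computable.fst.comp Computable.snd)))
  have hKmono : Monotone K := monotone_nat_of_le_succ fun n => by rw [hKs]; omega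
  have hK₀ : ∀ n, k₀ ≤ K n := fun n => le_trans (Nat.le_add_right _ _) (hKmono n.zero_le)
  have hKκ : ∀ n, κ n ≤ K n := by
    rintro (_ | n)
    · exact Nat.le_add_left _ _
    · rw [hKs]; omega
  have hKn : ∀ n, n ≤ K n := by
    intro n
    induction n with
    | zero => exact Nat.zero_le _
    | succ n ih =>
      rw [hKs]
      have : 2 ≤ κ (n + 1) := Nat.le_add_left _ _
      omega
  refine ⟨fun p => v (θ p.1, p.2), K, hv.comp ((hθc.comp Computable.fst).pair Computable.snd),
    hKc, fun w x hw hint => ?_⟩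
  have hint' : ∀ n, ι (w (K n)) ∈ interior (Set.range (D.map d)) := fun n => hint _ (hK₀ n)
  have hdom' : ∀ n, (v (θ n, w (K n))).Dom := fun n => hdom _ _ (hint' n)
  refine ⟨hdom', ?_⟩
  let B : ℕ → Fin (D.ar d) → X := fun n i => ι ((v (θ n, w (K n))).get (hdom' n) i)
  -- Compare both with the choice at precision `θ j` for the later term `w (K k)`: the second
  -- condition covers the change of term, the first one the change of precision.
  have hB : ∀ j k, j ≤ k → dist (B j) (B k) ≤ 2 * (posRat (θ j) : ℝ) := by
    intro j k hjk
    have hjdom : (v (θ j, w (K k))).Dom := hdom _ _ (hint' k)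
    have h₁ := hμv (θ j) (w (K j)) (w (K k)) (hint' j) (hint' k)
      ((hw.dist_lt (hKmono hjk)).trans
        (two_mul_half_pow_add_two_lt_posRat (μ (θ j)) (hKκ j)))
      _ (Part.get_mem (hdom' j)) _ (Part.get_mem hjdom)
    have h₂ := hθ (θ j) (θ k) (w (K k)) (hint' k) _ (Part.get_mem hjdom) _
      (Part.get_mem (hdom' k))
    rw [max_eq_left (posRat_two_pow_antitone hjk)] at h₂
    have h₃ := dist_triangle (B j) (fun i => ι ((v (θ j, w (K k))).get hjdom i)) (B k)
    linarith
  have hhalf : Filter.Tendsto (fun n : ℕ => (1 / 2 : ℝ) ^ n) Filter.atTop (nhds 0) :=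
    tendsto_pow_atTop_nhds_zero_of_lt_one (by norm_num) (by norm_num)
  obtain ⟨y, hlim⟩ := cauchySeq_tendsto_of_complete
    (cauchySeq_of_le_tendsto_0' _ (fun j k hjk => (hB j k hjk).trans (posRat_two_pow_lt j).le)
      hhalf)
  have hyB : ∀ n, dist y (B n) ≤ 2 * (posRat (θ n) : ℝ) := by
    intro n
    rw [dist_comm]
    refine le_of_tendsto (tendsto_const_nhds.dist hlim) ?_
    filter_upwards [Filter.eventually_ge_atTop n] with k hk using hB n k hk
  refine ⟨y, ?_, fun n b hb i => ?_⟩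
  -- The third condition gives exact preimages `z n` of the terms, ever closer to `B n`. They too
  -- converge to `y`, and continuity of the digit yields `d(y) = x`.
  · choose z hz hzB using fun n => hy (θ n) (w (K n)) (hint' n) _ (Part.get_mem (hdom' n))
    have hzlim : Filter.Tendsto z Filter.atTop (nhds y) := by
      refine hlim.congr_dist (squeeze_zero (fun _ => dist_nonneg) (fun n => ?_) hhalf)
      have h₁ : dist (B n) (z n) < posRat (θ n) := by rw [dist_comm]; exact hzB n
      have h₂ : (0 : ℝ) ≤ dist (B n) (z n) := dist_nonneg
      linarith [posRat_two_pow_lt n]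
    obtain ⟨q, _, hq⟩ := h.contracting d
    have h₁ := (hq.continuous.tendsto y).comp hzlim
    refine tendsto_nhds_unique h₁ ?_
    rw [tendsto_iff_dist_tendsto_zero]
    refine squeeze_zero (fun _ => dist_nonneg) (fun n => ?_) hhalf
    rw [Function.comp_apply, hz, dist_comm]
    exact (hw (K n)).le.trans (pow_le_pow_of_le_one (by norm_num) (by norm_num) (hKn n))
  · obtain rfl := Part.mem_unique (Part.get_mem (hdom' n)) hb
    exact ((dist_le_pi_dist y (B n) i).trans (hyB n)).trans_lt (posRat_two_pow_lt n)

/-- The step of the translation of names into trees. -/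
theorem IsComputableDigitSpace.exists_step (hD : D.IsComputableDigitSpace ι)
    (hcov : D.WellCovering) (hdec : D.IsDecidable ι) (hch : D.HasApproximableChoice ι) :
    ∃ (dig : Q → Fin m) (k₀ : ℕ) (K : Fin m × ℕ → ℕ) (V : Fin m × (ℕ × Q) × ℕ →. Q),
      Computable dig ∧ Computable K ∧ Partrec V ∧
      ∀ w x, IsCauchyName ι w x → ∃ y : Fin (D.ar (dig (w k₀))) → X, D.map _ y = x ∧
        ∀ i : Fin (D.ar (dig (w k₀))), ∃ w',
          (∀ n, w' n ∈ V (dig (w k₀), (n, w (K (dig (w k₀), n))), (i : ℕ))) ∧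
          IsCauchyName ι w' (y i) := by
  obtain ⟨dig, k₀, hdig, hk₀⟩ := exists_computable_digit hD.isDigitSpace.compact hcov hdec
  choose V K hV hK hVK using fun d => hch.exists_preimage_name hD.isDigitSpace k₀ d
  -- The tuple type depends on the digit; reading one component from a list gives a procedure with
  -- values in `Q`, uniform in the digit.
  refine ⟨dig, k₀, fun p => K p.1 p.2, fun p => (V p.1 p.2.1).bind fun b =>
    ((List.ofFn b)[p.2.2]? : Part Q), hdig, Computable.uncurry_finite hK, ?_, ?_⟩
  · refine Partrec.uncurry_finite (f := fun d (p : (ℕ × Q) × ℕ) =>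
      (V d p.1).bind fun b => ((List.ofFn b)[p.2]? : Part Q)) fun d => ?_
    exact ((hV d).comp Computable.fst).bind (Computable.ofOption
      (Computable.list_getElem?.comp (Computable.list_ofFn_app.comp Computable.snd)
        (Computable.snd.comp Computable.fst))).to₂
  · intro w x hw
    obtain ⟨hdom, y, hyx, hy⟩ := hVK _ w x hw (hk₀ w x hw)
    refine ⟨y, hyx, fun i => ⟨fun n => (V _ (n, w (K _ n))).get (hdom n) i, fun n => ?_,
      fun n => hy n _ (Part.get_mem _) i⟩⟩
    exact Part.mem_bind (Part.get_mem (hdom n)) (by simp)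

/-- Values of digits at basic elements can be computed uniformly. -/
theorem IsComputableDigitSpace.exists_computable_eval (hD : D.IsComputableDigitSpace ι) (u : Q) :
    ∃ g : Fin m × List Q × ℕ → Q, Computable g ∧ ∀ d l p,
      dist (D.map d fun i => ι (l.getD i u)) (ι (g (d, l, p))) < (1 / 2 : ℝ) ^ p := by
  choose g hg hgd using fun d => (hD.computable_map d).2
  refine ⟨fun p => g p.1 (fun i => p.2.1.getD i u, p.2.2), ?_, fun d l p => hgd d _ p⟩
  exact Computable.uncurry_finite (f := fun d (p : List Q × ℕ) =>
    g d (fun i => p.1.getD i u, p.2)) fun d => (hg d).comp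
      (((Computable.list_getD_fin u).comp Computable.fst).pair Computable.snd)

/-- Names of the values of trees can be computed. -/
theorem IsComputableDigitSpace.exists_treeToName (hD : D.IsComputableDigitSpace ι) :
    ∃ (F : InfTree D.ar → ℕ → Q) (ψ : List (List (List ℕ × Fin m)) × ℕ →. Q), Partrec ψ ∧
      (∀ T n, Approximates (fun k => ψ ((List.range k).map T.stream, n)) (F T n)) ∧
      ∀ T, IsCauchyName ι (F T) (hD.isDigitSpace.val T) := by
  have h := hD.isDigitSpace
  have := h.compact
  obtain ⟨u⟩ := hD.nonempty_basic
  obtain ⟨g, hg, hgd⟩ := hD.exists_computable_eval u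
  obtain ⟨E, hE, hET⟩ := exists_partrec_evalApprox D.ar hg u
  obtain ⟨q, hq1, hq⟩ := h.exists_factor
  obtain ⟨M, hM⟩ := Metric.isBounded_iff.1 (isCompact_univ (X := X)).isBounded
  obtain ⟨e, he⟩ := pow_unbounded_of_one_lt M (one_lt_two (α := ℝ))
  obtain ⟨c, hc⟩ := exists_pow_lt_of_lt_one (show (0 : ℝ) < 1 / 2 by norm_num)
    (show (q : ℝ) < 1 by exact_mod_cast hq1)
  -- As `q^c < 1/2` and `M < 2^e`, depth `J n` brings `q^J M` down to `2^{-(n+1)}`; precision `p n =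
  -- J n + (n + 1)` brings the rounding error `J 2^{-p}` below `2^{-(n+1)}`, because `J < 2^J`.
  let J : ℕ → ℕ := fun n => c * (n + 1 + e)
  have hJ : Computable J := (Primrec.nat_mul.comp (Primrec.const c)
    (Primrec.nat_add.comp Primrec.succ (Primrec.const e))).to_comp
  let p : ℕ → ℕ := fun n => J n + (n + 1)
  have hp : Computable p := Primrec.nat_add.to_comp.comp hJ Computable.succ
  refine ⟨fun T n => evalApprox g u (p n) (J n) T,
    fun a => (a.1[J a.2]? : Part _).bind fun L => E ((L, p a.2), J a.2), ?_, ?_, ?_⟩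
  · refine (Computable.ofOption
      (Computable.list_getElem?.comp Computable.fst (hJ.comp Computable.snd))).bind ?_
    exact hE.comp ((Computable.snd.pair (hp.comp (Computable.snd.comp Computable.fst))).pair
      (hJ.comp (Computable.snd.comp Computable.fst)))
  · intro T n
    exact (Approximates.getElem? T.stream (J n)).bind (f := fun _ L => E ((L, p n), J n))
      (.of_mem (hET T (J n) (p n)))
  · intro T n
    refine (h.dist_evalApprox_le hq1.le hq (fun x y => hM (Set.mem_univ x) (Set.mem_univ y))
      (fun d l p => (hgd d l p).le) (p n) (J n) T).trans_lt ?_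
    have h₁ : (q : ℝ) ^ J n * M ≤ (1 / 2) ^ (n + 1) := by
      have h₂ : (q : ℝ) ^ J n ≤ (1 / 2) ^ (n + 1 + e) := by
        rw [pow_mul]
        exact pow_le_pow_left₀ (by positivity) hc.le _
      calc (q : ℝ) ^ J n * M ≤ (q : ℝ) ^ J n * 2 ^ e := by gcongr
        _ ≤ (1 / 2) ^ (n + 1 + e) * 2 ^ e := by gcongr
        _ = (1 / 2) ^ (n + 1) := by
          rw [pow_add, mul_assoc, ← mul_pow]
          norm_num
    have h₂ : (J n : ℝ) * (1 / 2 : ℝ) ^ p n < (1 / 2) ^ (n + 1) := by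
      have h₃ : (J n : ℝ) < 2 ^ J n := by exact_mod_cast Nat.lt_two_pow_self
      calc (J n : ℝ) * (1 / 2 : ℝ) ^ p n < 2 ^ J n * (1 / 2 : ℝ) ^ p n := by gcongr
        _ = (1 / 2) ^ (n + 1) := by
          rw [pow_add, ← mul_assoc, ← mul_pow]
          norm_num
    calc _ < (1 / 2 : ℝ) ^ (n + 1) + (1 / 2) ^ (n + 1) := by linarith
      _ = (1 / 2) ^ n := by rw [pow_succ]; ring

end DigitSystem

/-! ### From names to trees -/

section NameToTree

open Nat.Partrec (Code)

variable {m : ℕ} {Q : Type v} [Primcodable Q]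

/-- Recursion along the reversed path: at the root, read the prefix; at child `i`, take the parent's
digit from its term `k₀`, and apply `V` to the parent's term of index `K`. -/
theorem partrec_childTerm_aux {dig : Q → Fin m} (k₀ : ℕ) {K : Fin m × ℕ → ℕ}
    {V : Fin m × (ℕ × Q) × ℕ →. Q} (hdig : Computable dig) (hK : Computable K) (hV : Partrec V)
    {γ : Type*} [Primcodable γ] {R : γ × (List Q × List ℕ × ℕ) →. Q} (hR : Partrec R) :
    Partrec fun a : γ × (List Q × List ℕ × ℕ) =>
      bif a.2.2.1.head?.isSome then
        (a.2.2.1.head? : Part ℕ).bind fun i =>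
          (R (a.1, a.2.1, a.2.2.1.tail, k₀)).bind fun b =>
            (R (a.1, a.2.1, a.2.2.1.tail, K (dig b, a.2.2.2))).bind fun b' =>
              V (dig b, (a.2.2.2, b'), i)
      else (a.2.1[a.2.2.2]? : Part Q) := by
  have hl : Computable fun a : γ × (List Q × List ℕ × ℕ) => a.2.1 :=
    Computable.fst.comp Computable.snd
  have hr : Computable fun a : γ × (List Q × List ℕ × ℕ) => a.2.2.1 :=
    Computable.fst.comp (Computable.snd.comp Computable.snd)
  have hn : Computable fun a : γ × (List Q × List ℕ × ℕ) => a.2.2.2 :=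
    Computable.snd.comp (Computable.snd.comp Computable.snd)
  have hhead : Computable fun a : γ × (List Q × List ℕ × ℕ) => a.2.2.1.head? :=
    Primrec.list_head?.to_comp.comp hr
  have htail : Computable fun a : γ × (List Q × List ℕ × ℕ) => a.2.2.1.tail :=
    Primrec.list_tail.to_comp.comp hr
  have hK' : Computable fun a : ((γ × (List Q × List ℕ × ℕ)) × ℕ) × Q =>
      K (dig a.2, a.1.1.2.2.2) :=
    hK.comp ((hdig.comp Computable.snd).pair (hn.comp (Computable.fst.comp Computable.fst)))
  have hR₀ : Partrec fun a : (γ × (List Q × List ℕ × ℕ)) × ℕ =>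
      R (a.1.1, a.1.2.1, a.1.2.2.1.tail, k₀) :=
    hR.comp ((Computable.fst.comp Computable.fst).pair ((hl.comp Computable.fst).pair
      ((htail.comp Computable.fst).pair (Computable.const k₀))))
  have hR₁ : Partrec fun a : ((γ × (List Q × List ℕ × ℕ)) × ℕ) × Q =>
      R (a.1.1.1, a.1.1.2.1, a.1.1.2.2.1.tail, K (dig a.2, a.1.1.2.2.2)) :=
    hR.comp ((Computable.fst.comp (Computable.fst.comp Computable.fst)).pair
      ((hl.comp (Computable.fst.comp Computable.fst)).pair
        ((htail.comp (Computable.fst.comp Computable.fst)).pair hK')))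
  have hV' : Partrec fun a : (((γ × (List Q × List ℕ × ℕ)) × ℕ) × Q) × Q =>
      V (dig a.1.2, (a.1.1.1.2.2.2, a.2), a.1.1.2) :=
    hV.comp ((hdig.comp (Computable.snd.comp Computable.fst)).pair
      (((hn.comp (Computable.fst.comp (Computable.fst.comp Computable.fst))).pair
        Computable.snd).pair (Computable.snd.comp (Computable.fst.comp Computable.fst))))
  exact Partrec.cond (Primrec.option_isSome.to_comp.comp hhead)
    ((Computable.ofOption hhead).bind ((hR₀.bind ((hR₁.bind hV'.to₂).to₂)).to₂))
    (Computable.ofOption (Computable.list_getElem?.comp hl hn))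

/-- The terms of the names that belong to the nodes of a tree, as a partial recursive function of
a prefix of the name of the root; a node is given by its reversed path. -/
theorem exists_partrec_nodeTerm {dig : Q → Fin m} (k₀ : ℕ) {K : Fin m × ℕ → ℕ}
    {V : Fin m × (ℕ × Q) × ℕ →. Q} (hdig : Computable dig) (hK : Computable K) (hV : Partrec V) :
    ∃ P : List Q × List ℕ × ℕ →. Q, Partrec P ∧ (∀ l n, P (l, [], n) = (l[n]? : Part Q)) ∧
      ∀ l i r n, P (l, i :: r, n) = (P (l, r, k₀)).bind fun b =>
        (P (l, r, K (dig b, n))).bind fun b' => V (dig b, (n, b'), i) := by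
  obtain ⟨c, hc⟩ := (partrec_childTerm_aux k₀ hdig hK hV
    (Code.partrec_run (α := List Q × List ℕ × ℕ))).exists_run_eq
  refine ⟨c.run Q, Code.partrec_run.comp ((Computable.const c).pair Computable.id),
    fun l n => ?_, fun l i r n => ?_⟩
  · rw [hc]
    simp
  · rw [hc]
    simp

/-- The recursion on the height for listing a segment below a node, again with `R` for the recursive
calls. -/
theorem partrec_nodeStream_aux (ar : Fin m → ℕ) {lab : List Q × List ℕ →. Fin m}
    (hlab : Partrec lab) {γ : Type*} [Primcodable γ]
    {R : γ × ((List Q × List ℕ) × ℕ) →. List (List ℕ × Fin m)} (hR : Partrec R) :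
    Partrec fun a : γ × ((List Q × List ℕ) × ℕ) =>
      (lab a.2.1).bind fun d =>
        (Nat.casesOn a.2.2 (Part.some [([], d)]) fun n =>
          (Part.listRange (fun i => (R (a.1, (a.2.1.1, i :: a.2.1.2), n)).map fun L =>
            L.map fun p => (i :: p.1, p.2)) (ar d)).map fun L => ([], d) :: L.flatten :
          Part (List (List ℕ × Fin m))) := by
  refine (hlab.comp (Computable.fst.comp Computable.snd)).bind ?_
  refine Partrec.nat_casesOn_right
    (f := fun a : (γ × ((List Q × List ℕ) × ℕ)) × Fin m => a.1.2.2)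
    (g := fun a => [([], a.2)]) (Computable.snd.comp (Computable.snd.comp Computable.fst)) ?_ ?_
  · exact Computable.list_cons.comp ((Computable.const []).pair Computable.snd)
      (Computable.const [])
  have hfst : Computable fun b : (((γ × ((List Q × List ℕ) × ℕ)) × Fin m) × ℕ) × ℕ =>
      b.1.1.1 := Computable.fst.comp (Computable.fst.comp Computable.fst)
  have h₁ : Partrec fun b : (((γ × ((List Q × List ℕ) × ℕ)) × Fin m) × ℕ) × ℕ =>
      R (b.1.1.1.1, (b.1.1.1.2.1.1, b.2 :: b.1.1.1.2.1.2), b.1.2) :=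
    hR.comp ((Computable.fst.comp hfst).pair
      (((Computable.fst.comp (Computable.fst.comp (Computable.snd.comp hfst))).pair
        (Computable.list_cons.comp Computable.snd
          (Computable.snd.comp (Computable.fst.comp (Computable.snd.comp hfst))))).pair
      (Computable.snd.comp Computable.fst)))
  have hmap : Primrec₂ fun (i : ℕ) (L : List (List ℕ × Fin m)) =>
      L.map fun p => (i :: p.1, p.2) :=
    Primrec.list_map Primrec.snd (Primrec.pair (Primrec.list_cons.comp
      (Primrec.fst.comp Primrec.fst) (Primrec.fst.comp Primrec.snd))
      (Primrec.snd.comp Primrec.snd))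
  have h₂ : Partrec₂ fun (b : ((γ × ((List Q × List ℕ) × ℕ)) × Fin m) × ℕ) (i : ℕ) =>
      (R (b.1.1.1, (b.1.1.2.1.1, i :: b.1.1.2.1.2), b.2)).map fun L =>
        L.map fun p => (i :: p.1, p.2) :=
    h₁.map (hmap.to_comp.comp (Computable.snd.comp Computable.fst) Computable.snd).to₂
  refine (Partrec.listRange h₂
    ((Primrec.dom_finite ar).to_comp.comp (Computable.snd.comp Computable.fst))).map ?_
  exact Computable.list_cons.comp
    ((Computable.const []).pair (Computable.snd.comp (Computable.fst.comp Computable.fst)))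
    (Primrec.list_flatten.to_comp.comp Computable.snd)

/-- The initial segments of the subtrees of a tree whose labels are computed by `lab`. -/
theorem exists_partrec_nodeStream (ar : Fin m → ℕ) {lab : List Q × List ℕ →. Fin m}
    (hlab : Partrec lab) :
    ∃ S : (List Q × List ℕ) × ℕ →. List (List ℕ × Fin m), Partrec S ∧
      (∀ l r, S ((l, r), 0) = (lab (l, r)).bind fun d => Part.some [([], d)]) ∧
      ∀ l r n, S ((l, r), n + 1) = (lab (l, r)).bind fun d =>
        (Part.listRange (fun i => (S ((l, i :: r), n)).map fun L =>
          L.map fun p => (i :: p.1, p.2)) (ar d)).map fun L => ([], d) :: L.flatten := by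
  obtain ⟨c, hc⟩ := (partrec_nodeStream_aux ar hlab
    (Code.partrec_run (α := (List Q × List ℕ) × ℕ))).exists_run_eq
  exact ⟨c.run _, Code.partrec_run.comp ((Computable.const c).pair Computable.id),
    fun l r => hc _, fun l r n => hc _⟩

end NameToTree

/-! ### The tree unfolded from a name -/

namespace DigitSystem

variable {X : Type u} {m : ℕ} [MetricSpace X] {D : DigitSystem X m} {Q : Type v}

/-- If the states of an unfolded tree denote points, and the points denoted by the successors of a
state are mapped to the point denoted by the state, then the tree denotes the same point. -/
theorem IsDigitSpace.val_unfold (h : D.IsDigitSpace) {S : Type*} {lab : S → Fin m}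
    {next : S → ℕ → S} {P : S → X → Prop}
    (hP : ∀ s x, P s x → ∃ y : Fin (D.ar (lab s)) → X, D.map _ y = x ∧
      ∀ i : Fin (D.ar (lab s)), P (next s i) (y i))
    {s : S} {x : X} (hs : P s x) : h.val (InfTree.unfold D.ar lab next s) = x := by
  refine h.val_eq fun n => ?_
  induction n generalizing s x with
  | zero =>
    obtain ⟨y, rfl, -⟩ := hP s x hs
    exact ⟨y, rfl⟩
  | succ n ih =>
    obtain ⟨y, rfl, hy⟩ := hP s x hs
    rw [InfTree.init, range_treeMap_node]
    refine ⟨y, fun i _ => ?_, rfl⟩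
    have hi := ih (hy i)
    rwa [← InfTree.subtree_unfold lab next s i] at hi

variable [Primcodable Q] {ι : Q → X}

open Classical in
/-- Trees with given values can be computed from names. -/
theorem IsComputableDigitSpace.exists_nameToTree (hD : D.IsComputableDigitSpace ι)
    (hcov : D.WellCovering) (hdec : D.IsDecidable ι) (hch : D.HasApproximableChoice ι) :
    ∃ (G : (ℕ → Q) → InfTree D.ar) (ψ : List Q × ℕ →. List (List ℕ × Fin m)), Partrec ψ ∧
      ∀ w x, IsCauchyName ι w x →
        (∀ n, Approximates (fun k => ψ ((List.range k).map w, n)) ((G w).stream n)) ∧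
        hD.isDigitSpace.val (G w) = x := by
  obtain ⟨dig, k₀, K, V, hdig, hK, hV, hstep⟩ := hD.exists_step hcov hdec hch
  let lab : (ℕ → Q) → Fin m := fun w => dig (w k₀)
  -- The default `w 0` only makes `next` total: for a Cauchy name `w` and `i` below the arity, `V`
  -- is defined.
  let next : (ℕ → Q) → ℕ → ℕ → Q := fun w i n =>
    if h : (V (lab w, (n, w (K (lab w, n))), i)).Dom then Part.get _ h else w 0
  have hnext : ∀ w x, IsCauchyName ι w x → ∃ y : Fin (D.ar (lab w)) → X, D.map _ y = x ∧
      ∀ i : Fin (D.ar (lab w)),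
        (∀ n, next w i n ∈ V (lab w, (n, w (K (lab w, n))), (i : ℕ))) ∧
        IsCauchyName ι (next w i) (y i) := by
    intro w x hw
    obtain ⟨y, hyx, hy⟩ := hstep w x hw
    refine ⟨y, hyx, fun i => ?_⟩
    obtain ⟨w', hw', hname⟩ := hy i
    have hmem : ∀ n, next w i n ∈ V (lab w, (n, w (K (lab w, n))), (i : ℕ)) := by
      intro n
      have hdom : (V (lab w, (n, w (K (lab w, n))), (i : ℕ))).Dom := Part.dom_iff_mem.2 ⟨_, hw' n⟩
      simp only [next, dif_pos hdom]
      exact Part.get_mem hdom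
    have heq : next w i = w' := funext fun n => Part.mem_unique (hmem n) (hw' n)
    exact ⟨hmem, heq ▸ hname⟩
  obtain ⟨P, hP, hPnil, hPcons⟩ := exists_partrec_nodeTerm k₀ hdig hK hV
  have hlab : Partrec fun a : List Q × List ℕ => (P (a.1, a.2, k₀)).map dig :=
    (hP.comp (Computable.fst.pair (Computable.snd.pair (Computable.const k₀)))).map
      (hdig.comp Computable.snd).to₂
  obtain ⟨S, hS, hSzero, hSsucc⟩ := exists_partrec_nodeStream D.ar hlab
  refine ⟨InfTree.unfold D.ar lab next, fun a => S ((a.1, []), a.2),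
    hS.comp ((Computable.fst.pair (Computable.const [])).pair Computable.snd),
    fun w x hw => ⟨fun n => ?_, ?_⟩⟩
  -- Invariant: `t` is the name attached to the node with reversed path `r`, and `P` approximates
  -- its terms from prefixes of `w`. That `t` is a Cauchy name guarantees the names of the children.
  · have key : ∀ (n : ℕ) (r : List ℕ) (t : ℕ → Q) (z : X), IsCauchyName ι t z →
        (∀ j, Approximates (fun k => P ((List.range k).map w, r, j)) (t j)) →
        Approximates (fun k => S (((List.range k).map w, r), n))
          ((InfTree.unfold D.ar lab next t).stream n) := by
      intro n
      induction n with
      | zero =>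
        intro r t z _ hr
        simp only [hSzero, InfTree.stream_unfold_zero]
        exact ((hr k₀).map dig).bind (.of_mem (Part.mem_some _))
      | succ n ih =>
        intro r t z ht hr
        obtain ⟨y, -, hy⟩ := hnext t z ht
        simp only [hSsucc, InfTree.stream_unfold_succ]
        refine ((hr k₀).map dig).bind (Approximates.map (Approximates.listRange fun i hi => ?_)
          fun L => ([], lab t) :: L.flatten)
        refine Approximates.map (ih (i :: r) (next t i) _ (hy ⟨i, hi⟩).2 fun j => ?_) _
        simp only [hPcons]
        exact (hr k₀).bind ((hr _).bind (.of_mem ((hy ⟨i, hi⟩).1 j)))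
    refine key n [] w x hw fun j => ?_
    simp only [hPnil]
    exact Approximates.getElem? w j
  · refine hD.isDigitSpace.val_unfold (P := IsCauchyName ι) (fun t z ht => ?_) hw
    obtain ⟨y, hyz, hy⟩ := hnext t z ht
    exact ⟨y, hyz, fun i => (hy i).2⟩

end DigitSystem

/-! ### Equivalence of the two representations -/

theorem mainTheorem2 {X : Type u} [MetricSpace X] {m : ℕ} (D : DigitSystem X m)
    {Q : Type v} [Primcodable Q] (ι : Q → X)
    (hD : D.IsComputableDigitSpace ι) (hcov : D.WellCovering)
    (hdec : D.IsDecidable ι) (hch : D.HasApproximableChoice ι) :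
    (∃ (F : InfTree D.ar → ℕ → Q) (G : (ℕ → Q) →. InfTree D.ar),
      IsComputableOperator InfTree.stream id (F : InfTree D.ar →. (ℕ → Q)) ∧
      IsComputableOperator id InfTree.stream G ∧
      (∀ T : InfTree D.ar, cauchyRep ι (F T) = Part.some (hD.isDigitSpace.val T)) ∧
      G.Dom = (cauchyRep ι).Dom ∧
      ∀ w : ℕ → Q, ∀ T ∈ G w, Part.some (hD.isDigitSpace.val T) = cauchyRep ι w) ∧
    RepEquiv (treeRep hD.isDigitSpace) (cauchyRep ι) := by
  obtain ⟨F, ψF, hψF, hF, hFval⟩ := hD.exists_treeToName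
  obtain ⟨G, ψG, hψG, hG⟩ := hD.exists_nameToTree hcov hdec hch
  -- The total function `G` is cut down to the domain of `cauchyRep`, where its properties are
  -- known.
  refine ⟨⟨F, fun w => (cauchyRep ι w).map fun _ => G w, ?_, ?_, ?_, ?_, ?_⟩, ?_, ?_⟩
  · refine .of_approximates hψF fun T b hb n => ?_
    obtain rfl := Part.mem_some_iff.1 hb
    exact hF T n
  · refine .of_approximates hψG fun w T hT n => ?_
    obtain ⟨x, hx, rfl⟩ := (Part.mem_map_iff _).1 hT
    exact (hG w x (isCauchyName_of_mem_cauchyRep hx)).1 n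
  · exact fun T => (hFval T).cauchyRep_eq
  · rfl
  · intro w T hT
    obtain ⟨x, hx, rfl⟩ := (Part.mem_map_iff _).1 hT
    have hw := isCauchyName_of_mem_cauchyRep hx
    rw [(hG w x hw).2, hw.cauchyRep_eq]
  · refine ⟨fun p => ⟨∃ T : InfTree D.ar, T.stream = p, fun h => F h.choose⟩, ?_, ?_⟩
    · refine .of_approximates hψF ?_
      rintro p b ⟨hp, rfl⟩ n
      have := hF hp.choose n
      rwa [hp.choose_spec] at this
    · rintro p x ⟨hp, rfl⟩
      refine ⟨F hp.choose, ⟨hp, rfl⟩, ?_⟩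
      rw [(hFval _).cauchyRep_eq]
      exact Part.mem_some _
  · refine ⟨fun w => (cauchyRep ι w).map fun _ => (G w).stream, ?_, ?_⟩
    · refine .of_approximates hψG fun w b hb n => ?_
      obtain ⟨x, hx, rfl⟩ := (Part.mem_map_iff _).1 hb
      exact (hG w x (isCauchyName_of_mem_cauchyRep hx)).1 n
    · intro w x hx
      refine ⟨(G w).stream, Part.mem_map (fun _ => (G w).stream) hx, ⟨G w, rfl⟩, ?_⟩
      have hT : ∃ T : InfTree D.ar, T.stream = (G w).stream := ⟨G w, rfl⟩
      change hD.isDigitSpace.val hT.choose = x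
      rw [InfTree.stream_injective hT.choose_spec]
      exact (hG w x (isCauchyName_of_mem_cauchyRep hx)).2
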